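/- Let $A$ be an AW*-algebra, that is, a (unital, complex) C*-algebra in which the right annihilator of any subset is of the form $pA$ for a single projection $p$. Order the projections of $A$ by $e \le f$ iff $e = ef$, and write $e \sim f$ if $e = vv^*$ and $f = v^*v$ for some $v \in A$. For an orthogonal family of projections, $\sum_i e_i$ denotes its supremum in the set of projections of $A$. A projection $e$ is properly infinite if it is nonzero and $e = e_1 + e_2$ for some projections $e_1 \sim e_2 \sim e$. For a properly infinite projection $e$ of $A$, let $\Delta(e)$ be the set of cardinals $\operatorname{card}(I)$ of the index sets of orthogonal families $\{e_i\}_{i \in I}$ of projections with $e = \sum_{i \in I} e_i$ and $e_i \sim e$ for all $i$, and let $\delta(e) = \sup \Delta(e)$. Call a cardinal weakly inaccessible if it is an uncountable regular limit cardinal. Proposition. Let $e$ be a properly infinite projection in an AW*-algebra. If the cardinal $\delta(e)$ is not weakly inaccessible, then $\delta(e) \in \Delta(e)$; that is, the supremum defining $\delta(e)$ is attained. -/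

import Mathlib

universe u

/-- A (unital, complex) C⋆-algebra is an AW⋆-algebra when the right annihilator
`{x | ∀ s ∈ S, s * x = 0}` of every subset `S` is the right ideal `p A` generated by a single
projection `p`. -/
class IsAWStarAlgebra (A : Type u) [CStarAlgebra A] : Prop where
  exists_annihilator_eq : ∀ S : Set A, ∃ p : A, IsStarProjection p ∧
    {x : A | ∀ s ∈ S, s * x = 0} = Set.range (fun a : A => p * a)

/-- The projections (self-adjoint idempotents) of a C⋆-algebra. -/
@[ext]
structure AWProj (A : Type u) [CStarAlgebra A] where
  val : A
  isProj : IsStarProjection val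

namespace AWProj

variable {A : Type u} [CStarAlgebra A]

/-- Projections are ordered by `e ≤ f` iff `e = e f`. -/
instance instPartialOrder : PartialOrder (AWProj A) where
  le e f := e.val = e.val * f.val
  le_refl e := e.isProj.isIdempotentElem.eq.symm
  le_trans e f g hef hfg := by
    calc e.val = e.val * f.val := hef
      _ = e.val * (f.val * g.val) := congrArg (e.val * ·) hfg
      _ = e.val * f.val * g.val := (mul_assoc _ _ _).symm
      _ = e.val * g.val := congrArg (· * g.val) hef.symm
  le_antisymm e f hef hfe := by
    have h := congrArg star hef
    rw [star_mul, e.isProj.isSelfAdjoint.star_eq, f.isProj.isSelfAdjoint.star_eq] at h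
    exact AWProj.ext (h.trans hfe.symm)

/-- Equivalence of projections: `e = v v⋆` and `f = v⋆ v` for some `v` in the algebra. -/
def Equivalent (e f : AWProj A) : Prop :=
  ∃ v : A, e.val = v * star v ∧ f.val = star v * v

/-- A projection `e` is properly infinite when it is nonzero and `e = e₁ + e₂` for
projections `e₁ ∼ e₂ ∼ e`. -/
def IsProperlyInfinite (e : AWProj A) : Prop :=
  e.val ≠ 0 ∧ ∃ e₁ e₂ : AWProj A,
    e₁.Equivalent e₂ ∧ e₂.Equivalent e ∧ e.val = e₁.val + e₂.val

/-- `e = ∑ eᵢ` for an orthogonal family of projections: `e` is the supremum of the `eᵢ` in the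
partially ordered set of projections. -/
def IsOrthogonalSum {I : Type u} (f : I → AWProj A) (e : AWProj A) : Prop :=
  (Pairwise fun i j => (f i).val * (f j).val = 0) ∧ IsLUB (Set.range f) e

/-- `f` belongs to `Γ(e)`: it is an orthogonal family of projections with sum `e`, all of whose
members are equivalent to `e`. -/
def MemGamma (e : AWProj A) {I : Type u} (f : I → AWProj A) : Prop :=
  IsOrthogonalSum f e ∧ ∀ i, (f i).Equivalent e

/-- `Δ(e)`: the set of cardinalities of the families in `Γ(e)`. For `e ≠ 0` such a family is
injective (see `MemGamma.injective`), so index types in the universe of `A` suffice. -/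
def Delta (e : AWProj A) : Set Cardinal.{u} :=
  {c | ∃ (I : Type u) (f : I → AWProj A), e.MemGamma f ∧ Cardinal.mk I = c}

/-- `δ(e) = sup Δ(e)`; for `e ≠ 0` this is a supremum of a bounded set, by `bddAbove_Delta`. -/
noncomputable def delta (e : AWProj A) : Cardinal.{u} :=
  sSup e.Delta

theorem MemGamma.injective {e : AWProj A} (he : e.val ≠ 0) {I : Type u} {f : I → AWProj A}
    (hf : e.MemGamma f) : Function.Injective f := by
  intro i j hij
  by_contra hne
  have h0 : (f i).val = 0 := by
    have h : (f i).val * (f j).val = 0 := hf.1.1 hne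
    rwa [← hij, (f i).isProj.isIdempotentElem.eq] at h
  obtain ⟨v, hv, hv'⟩ := hf.2 i
  have hv0 : v = 0 := CStarRing.mul_star_self_eq_zero_iff v |>.1 (hv.symm.trans h0)
  exact he (by rw [hv', hv0, mul_zero])

theorem bddAbove_Delta {e : AWProj A} (he : e.val ≠ 0) : BddAbove e.Delta := by
  refine ⟨Cardinal.mk (AWProj A), ?_⟩
  rintro c ⟨I, f, hf, rfl⟩
  exact Cardinal.mk_le_of_injective (MemGamma.injective he hf)

end AWProj

/-- A cardinal is weakly inaccessible if it is an uncountable regular limit cardinal. -/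
def IsWeaklyInaccessible (c : Cardinal.{u}) : Prop :=
  Cardinal.aleph0 < c ∧ c.IsRegular ∧ Order.IsSuccLimit c

/-! `Δ(e)` contains `ℵ₀`, is closed downwards among nonzero cardinals, and is closed under sums: if
`card I` and all `c i` lie in it, so does `∑ c i` (subdivide each member of a family indexed by
`I`). If `δ(e)` is `ℵ₀`, it belongs to `Δ(e)`; if it is not a limit, a supremum is attained; if it
is a singular limit, it is a sum of fewer than `δ(e)` smaller nonzero cardinals, all in `Δ(e)`. Only
the regular uncountable limit case escapes.

Downward closure groups members of a family together; each group stays equivalent to `e` by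
Schröder–Bernstein (`Equivalent.of_le_of_le`), since it lies between one of its members and `e`.
Suprema are handled through annihilators (`isLUB_iff`). -/

/-- Knaster–Tarski in an initial segment of a partial order with all suprema. -/
theorem exists_fixedPoint_Iic {P : Type*} [PartialOrder P] (hP : ∀ S : Set P, ∃ a, IsLUB S a)
    {e : P} (F : Set.Iic e → Set.Iic e) (hF : Monotone F) : ∃ p, F p = p := by
  obtain ⟨a, ha⟩ := hP (Subtype.val '' {q : Set.Iic e | q ≤ F q})
  have hae : a ≤ e := ha.2 (by rintro _ ⟨q, -, rfl⟩; exact q.2)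
  have hub : ∀ q : Set.Iic e, q ≤ F q → q ≤ ⟨a, hae⟩ := fun q hq => ha.1 ⟨q, hq, rfl⟩
  have hle : (⟨a, hae⟩ : Set.Iic e) ≤ F ⟨a, hae⟩ := by
    refine ha.2 (show (F ⟨a, hae⟩).1 ∈ upperBounds _ from ?_)
    rintro _ ⟨q, hq, rfl⟩
    exact le_trans (show q ≤ F q from hq) (hF (hub q hq))
  exact ⟨⟨a, hae⟩, le_antisymm (hub _ (hF hle)) hle⟩

/-- A singular cardinal is a sum of fewer smaller nonzero cardinals. -/
theorem Cardinal.exists_sum_eq_of_cof_lt {c : Cardinal.{u}} (hc : aleph0 ≤ c)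
    (hcof : c.ord.cof < c) (hlim : Order.IsSuccLimit c) :
    ∃ (ι : Type u) (a : ι → Cardinal.{u}), mk ι < c ∧ (∀ i, a i ≠ 0 ∧ a i < c) ∧ sum a = c := by
  obtain ⟨s, hs, hsc⟩ := Order.exists_cof_eq c.ord.ToType
  rw [Ordinal.cof_toType] at hsc
  have hlt (x : c.ord.ToType) : Order.succ (x.toOrd : Ordinal).card < c :=
    hlim.succ_lt (lt_ord.1 x.toOrd.2)
  -- Index by a cofinal set of least size. Successors keep the summands nonzero and make some
  -- summand exceed any given `d < c`.
  refine ⟨s, fun i => Order.succ (i.1.toOrd : Ordinal).card, hsc ▸ hcof,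
    fun i => ⟨(Order.bot_lt_succ _).ne', hlt _⟩, le_antisymm ?_ ?_⟩
  · refine (sum_le_mk_mul_iSup _).trans (mul_le_of_le hc (hsc ▸ hcof.le) ?_)
    exact ciSup_le' fun i => (hlt _).le
  · refine le_of_forall_lt fun d hd => ?_
    obtain ⟨y, hy, hxy⟩ := hs (Ordinal.ToType.mk ⟨d.ord, ord_lt_ord.2 hd⟩)
    refine lt_of_lt_of_le (Order.lt_succ_of_le ?_)
      (le_sum (fun i : s => Order.succ (i.1.toOrd : Ordinal).card) ⟨y, hy⟩)
    rw [← ord_le]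
    exact (Ordinal.ToType.mk.le_symm_apply).2 hxy

namespace AWProj

variable {A : Type u} [CStarAlgebra A]

theorem mul_val (e : AWProj A) : e.val * e.val = e.val := e.isProj.isIdempotentElem.eq

theorem star_val (e : AWProj A) : star e.val = e.val := e.isProj.isSelfAdjoint.star_eq

theorem le_iff_left {e f : AWProj A} : e ≤ f ↔ e.val * f.val = e.val := eq_comm

theorem le_iff_right {e f : AWProj A} : e ≤ f ↔ f.val * e.val = e.val := by
  rw [le_iff_left, ← star_inj, star_mul, star_val, star_val]

theorem mul_eq_zero_comm {e f : AWProj A} : e.val * f.val = 0 ↔ f.val * e.val = 0 := by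
  rw [← star_inj, star_mul, star_val, star_val, star_zero]

theorem mul_eq_zero_of_le {e f : AWProj A} (h : e ≤ f) {x : A} (hfx : f.val * x = 0) :
    e.val * x = 0 := by
  rw [← le_iff_left.1 h, mul_assoc, hfx, mul_zero]

theorem mul_eq_zero_of_le_of_le {e e' f f' : AWProj A} (he : e ≤ e') (hf : f ≤ f')
    (h : e'.val * f'.val = 0) : e.val * f.val = 0 :=
  mul_eq_zero_of_le he (mul_eq_zero_comm.1 (mul_eq_zero_of_le hf (mul_eq_zero_comm.1 h)))

/-- The complementary projection `1 - e`. -/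
def compl (e : AWProj A) : AWProj A := ⟨1 - e.val, e.isProj.one_sub⟩

theorem le_iff_mul_compl {e f : AWProj A} : e ≤ f ↔ e.val * f.compl.val = 0 := by
  rw [le_iff_left, compl, mul_sub, mul_one, sub_eq_zero, eq_comm]

/-! ### Suprema -/

/-- Testing on `x = 1 - u` turns right annihilators into upper bounds. -/
theorem isLUB_of_forall_mul_eq_zero_iff {S : Set (AWProj A)} {e : AWProj A}
    (h : ∀ x : A, (∀ s ∈ S, s.val * x = 0) ↔ e.val * x = 0) : IsLUB S e := by
  constructor
  · intro s hs
    exact le_iff_mul_compl.2 ((h _).2 (le_iff_mul_compl.1 le_rfl) s hs)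
  · intro u hu
    exact le_iff_mul_compl.2 ((h _).1 fun s hs => le_iff_mul_compl.1 (hu hs))

theorem exists_forall_mul_eq_zero_iff [IsAWStarAlgebra A] (S : Set (AWProj A)) :
    ∃ e : AWProj A, ∀ x : A, (∀ s ∈ S, s.val * x = 0) ↔ e.val * x = 0 := by
  obtain ⟨p, hp, h⟩ := IsAWStarAlgebra.exists_annihilator_eq (AWProj.val '' S)
  refine ⟨⟨1 - p, hp.one_sub⟩, fun x => ?_⟩
  have hx := Set.ext_iff.1 h x
  simp only [Set.mem_ofPred_eq, Set.forall_mem_image, Set.mem_range] at hx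
  rw [hx, sub_mul, one_mul, sub_eq_zero]
  constructor
  · rintro ⟨a, rfl⟩
    rw [← mul_assoc, hp.isIdempotentElem.eq]
  · intro hx
    exact ⟨x, hx.symm⟩

theorem exists_isLUB [IsAWStarAlgebra A] (S : Set (AWProj A)) : ∃ e, IsLUB S e :=
  (exists_forall_mul_eq_zero_iff S).imp fun _ => isLUB_of_forall_mul_eq_zero_iff

theorem isLUB_iff [IsAWStarAlgebra A] {S : Set (AWProj A)} {e : AWProj A} :
    IsLUB S e ↔ ∀ x : A, (∀ s ∈ S, s.val * x = 0) ↔ e.val * x = 0 := by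
  refine ⟨fun h => ?_, isLUB_of_forall_mul_eq_zero_iff⟩
  obtain ⟨f, hf⟩ := exists_forall_mul_eq_zero_iff S
  rwa [h.unique (isLUB_of_forall_mul_eq_zero_iff hf)]

theorem isLUB_range_iff [IsAWStarAlgebra A] {I : Type*} {f : I → AWProj A} {e : AWProj A} :
    IsLUB (Set.range f) e ↔ ∀ x : A, (∀ i, (f i).val * x = 0) ↔ e.val * x = 0 := by
  rw [isLUB_iff]
  simp only [Set.forall_mem_range]

/-! ### Equivalence of projections -/

/-- By the C⋆-identity it suffices that `(ev - v)(ev - v)⋆ = 0`. -/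
theorem mul_of_mul_star_eq {e : AWProj A} {v : A} (h : e.val = v * star v) : e.val * v = v := by
  rw [← sub_eq_zero, ← CStarRing.mul_star_self_eq_zero_iff]
  have h1 : e.val * v * (star v * e.val) = e.val := by
    rw [mul_assoc, ← mul_assoc v, ← h, mul_val, mul_val]
  have h2 : e.val * v * star v = e.val := by rw [mul_assoc, ← h, mul_val]
  have h3 : v * (star v * e.val) = e.val := by rw [← mul_assoc, ← h, mul_val]
  rw [star_sub, star_mul, star_val, sub_mul, mul_sub, mul_sub, h1, h2, h3, ← h]
  abel

theorem mul_of_star_mul_eq {e : AWProj A} {v : A} (h : e.val = star v * v) : v * e.val = v := by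
  have := congrArg star (mul_of_mul_star_eq (e := e) (v := star v) (by rw [star_star, h]))
  rwa [star_mul, star_star, star_val] at this

theorem Equivalent.symm {e f : AWProj A} (h : e.Equivalent f) : f.Equivalent e := by
  obtain ⟨v, h1, h2⟩ := h
  exact ⟨star v, by rw [star_star, h2], by rw [star_star, h1]⟩

theorem Equivalent.trans {e f g : AWProj A} (h : e.Equivalent f) (h' : f.Equivalent g) :
    e.Equivalent g := by
  obtain ⟨v, h1, h2⟩ := h
  obtain ⟨w, h3, h4⟩ := h'
  refine ⟨v * w, ?_, ?_⟩
  · rw [star_mul, mul_assoc, ← mul_assoc w, ← h3, ← mul_assoc, mul_of_star_mul_eq h2, h1]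
  · rw [star_mul, mul_assoc, ← mul_assoc (star v), ← h2, mul_of_mul_star_eq h3, h4]

/-- The projection `v⋆ q v`, for `q` dominated by the range projection of `v`. -/
def conj {e : AWProj A} {v : A} (h : e.val = v * star v) (q : AWProj A) (hq : q ≤ e) :
    AWProj A where
  val := star v * q.val * v
  isProj := by
    rw [isStarProjection_iff']
    constructor
    · calc star v * q.val * v * (star v * q.val * v)
          = star v * (q.val * (v * star v) * q.val) * v := by noncomm_ring
        _ = star v * q.val * v := by rw [← h, le_iff_left.1 hq, mul_val]
    · rw [star_mul, star_mul, star_star, star_val, mul_assoc]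

theorem conj_mono {e : AWProj A} {v : A} (h : e.val = v * star v) {p q : AWProj A} (hq : q ≤ e)
    (hpq : p ≤ q) : conj h p (hpq.trans hq) ≤ conj h q hq := by
  rw [le_iff_left]
  calc star v * p.val * v * (star v * q.val * v)
      = star v * (p.val * (v * star v) * q.val) * v := by noncomm_ring
    _ = star v * p.val * v := by rw [← h, le_iff_left.1 (hpq.trans hq), le_iff_left.1 hpq]

theorem conj_le {e f : AWProj A} {v : A} (h : e.val = v * star v) (h' : f.val = star v * v)
    {q : AWProj A} (hq : q ≤ e) : conj h q hq ≤ f := by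
  rw [le_iff_left]
  change star v * q.val * v * f.val = star v * q.val * v
  rw [mul_assoc, mul_of_star_mul_eq h']

theorem conj_equivalent {e : AWProj A} {v : A} (h : e.val = v * star v) {q : AWProj A}
    (hq : q ≤ e) : (conj h q hq).Equivalent q := by
  refine ⟨star v * q.val, ?_, ?_⟩
  · change star v * q.val * v = _
    rw [star_mul, star_star, star_val, mul_assoc, mul_assoc, ← mul_assoc q.val q.val, mul_val]
  · rw [star_mul, star_star, star_val, mul_assoc, ← mul_assoc v, ← h, ← mul_assoc,
      le_iff_left.1 hq, mul_val]

/-- The sum of two orthogonal projections. -/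
def add (e f : AWProj A) (h : e.val * f.val = 0) : AWProj A where
  val := e.val + f.val
  isProj := e.isProj.add f.isProj h

/-- The difference of two comparable projections. -/
def sub (e f : AWProj A) (h : f ≤ e) : AWProj A where
  val := e.val - f.val
  isProj := by
    rw [isStarProjection_iff', star_sub, star_val, star_val, sub_mul, mul_sub, mul_sub, mul_val,
      mul_val, le_iff_left.1 h, le_iff_right.1 h]
    simp

/-- A Schröder–Bernstein theorem for projections. -/
theorem Equivalent.of_le_of_le [IsAWStarAlgebra A] {e f g : AWProj A} (h : f.Equivalent e)
    (hfg : f ≤ g) (hge : g ≤ e) : g.Equivalent e := by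
  obtain ⟨v, he, hf⟩ := h.symm
  have hdf : ∀ q : Set.Iic e, (e.sub g hge).val * (conj he q.1 q.2).val = 0 := fun q => by
    have := (conj_le he hf q.2).trans hfg
    change (e.val - g.val) * _ = 0
    rw [sub_mul, le_iff_right.1 this, le_iff_right.1 (this.trans hge), sub_self]
  have hFe : ∀ q : Set.Iic e, (e.sub g hge).add (conj he q.1 q.2) (hdf q) ≤ e := fun q => by
    rw [le_iff_left]
    change (e.val - g.val + _) * e.val = e.val - g.val + _
    rw [add_mul, sub_mul, mul_val, le_iff_left.1 hge,
      le_iff_left.1 (((conj_le he hf q.2).trans hfg).trans hge)]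
  -- The fixed point satisfies `p = (e - g) + v⋆ p v`, hence `g = v⋆ p v + (e - p)`.
  obtain ⟨⟨p, hpe⟩, hp⟩ := exists_fixedPoint_Iic exists_isLUB
    (fun q : Set.Iic e => ⟨(e.sub g hge).add (conj he q.1 q.2) (hdf q), hFe q⟩) (by
      intro q r hqr
      change (e.sub g hge).add (conj he q.1 q.2) (hdf q) ≤
        (e.sub g hge).add (conj he r.1 r.2) (hdf r)
      rw [le_iff_left]
      change ((e.sub g hge).val + (conj he q.1 q.2).val) *
        ((e.sub g hge).val + (conj he r.1 r.2).val) =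
        (e.sub g hge).val + (conj he q.1 q.2).val
      rw [add_mul, mul_add, mul_add, mul_val, hdf r, mul_eq_zero_comm.1 (hdf q),
        le_iff_left.1 (conj_mono he r.2 hqr), add_zero, zero_add])
  have hpval : e.val - g.val + star v * p.val * v = p.val :=
    congrArg AWProj.val (congrArg Subtype.val hp)
  have hcp : star v * p.val * v * p.val = star v * p.val * v := by
    have h2 : (star v * p.val * v) * (e.val - g.val) = 0 := mul_eq_zero_comm.1 (hdf ⟨p, hpe⟩)
    have h3 : (star v * p.val * v) * (star v * p.val * v) = star v * p.val * v :=
      (conj he p hpe).mul_val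
    calc star v * p.val * v * p.val
        = star v * p.val * v * (e.val - g.val + star v * p.val * v) := by rw [hpval]
      _ = star v * p.val * v := by rw [mul_add, h2, zero_add, h3]
  have hpv : p.val * v * p.val = p.val * v := by
    have := congrArg (v * ·) hcp
    simp only [← mul_assoc, ← he, le_iff_right.1 hpe] at this
    exact this
  have hve : v * e.val = v := by
    rw [← mul_of_star_mul_eq hf, mul_assoc, le_iff_left.1 (hfg.trans hge)]
  have h1 : p.val * (e.val - p.val) = 0 := by
    rw [mul_sub, mul_val, le_iff_left.1 hpe, sub_self]
  have h2 : (e.val - p.val) * p.val = 0 := by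
    rw [sub_mul, mul_val, le_iff_right.1 hpe, sub_self]
  have h3 : (e.val - p.val) * (e.val - p.val) = e.val - p.val := (e.sub p hpe).mul_val
  have h4 : p.val * v * (e.val - p.val) = 0 := by
    rw [mul_sub, hpv, mul_assoc, hve, sub_self]
  have h5 : (e.val - p.val) * (star v * p.val) = 0 := by
    have := congrArg star h4
    simpa [star_mul, star_val] using this
  have hg : ∀ E G C P : A, E - G + C = P → G = C + (E - P) := by
    rintro E G C P rfl
    abel
  have hstar : star (star v * p.val + (e.val - p.val)) = p.val * v + (e.val - p.val) := by
    simp [star_mul, star_val]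
  -- This partial isometry acts as `v⋆` on `p` and as the identity on `e - p`.
  refine ⟨star v * p.val + (e.val - p.val), ?_, ?_⟩
  · rw [hg _ _ _ _ hpval, hstar, add_mul, mul_add, mul_add, h3,
      mul_assoc (star v) p.val (e.val - _), h1, ← mul_assoc (e.val - _), h2, ← mul_assoc (star v * p.val),
      mul_assoc (star v) p.val p.val, mul_val]
    simp
  · rw [hstar, add_mul, mul_add, mul_add, h3, h4, h5, mul_assoc p.val, ← mul_assoc v, ← he,
      le_iff_right.1 hpe, mul_val]
    simp

/-! ### Families of equivalent projections -/

theorem MemGamma.exists_of_equivalent [IsAWStarAlgebra A] {e e' : AWProj A} {I : Type u}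
    {f : I → AWProj A} (hf : e.MemGamma f) (h : e.Equivalent e') :
    ∃ f' : I → AWProj A, e'.MemGamma f' := by
  obtain ⟨v, he, he'⟩ := h
  have hfe : ∀ i, f i ≤ e := fun i => hf.1.2.1 ⟨i, rfl⟩
  refine ⟨fun i => conj he (f i) (hfe i), ⟨?_, ?_⟩, fun i => ?_⟩
  · intro i j hij
    calc star v * (f i).val * v * (star v * (f j).val * v)
        = star v * ((f i).val * (v * star v) * (f j).val) * v := by noncomm_ring
      _ = 0 := by rw [← he, le_iff_left.1 (hfe i), hf.1.1 hij, mul_zero, zero_mul]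
  · rw [isLUB_range_iff]
    intro x
    have key : ∀ q : AWProj A, q ≤ e → (star v * q.val * v * x = 0 ↔ q.val * (v * x) = 0) := by
      intro q hq
      constructor
      · intro hx
        have := congrArg (v * ·) hx
        simpa only [← mul_assoc, ← he, le_iff_right.1 hq, mul_zero] using this
      · intro hx
        rw [mul_assoc, mul_assoc, hx, mul_zero]
    have hev : star v * e.val * v = e'.val := by
      rw [mul_assoc, mul_of_mul_star_eq he, he']
    rw [← hev, key e le_rfl, ← isLUB_range_iff.1 hf.1.2]
    exact forall_congr' fun i => key (f i) (hfe i)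
  · exact (conj_equivalent he (hfe i)).trans ((hf.2 i).trans ⟨v, he, he'⟩)

/-- The members of a family in `Γ(e)` can be grouped together along a surjection. -/
theorem MemGamma.exists_of_surjective [IsAWStarAlgebra A] {e : AWProj A} {I J : Type u}
    {f : I → AWProj A} (hf : e.MemGamma f) {π : I → J} (hπ : Function.Surjective π) :
    ∃ g : J → AWProj A, e.MemGamma g := by
  choose g hg using fun j => exists_isLUB (f '' (π ⁻¹' {j}))
  have hfg : ∀ i, f i ≤ g (π i) := fun i => (hg (π i)).1 ⟨i, rfl, rfl⟩
  have hge : ∀ j, g j ≤ e := fun j => (hg j).2 (by rintro _ ⟨i, -, rfl⟩; exact hf.1.2.1 ⟨i, rfl⟩)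
  refine ⟨g, ⟨?_, ?_⟩, fun j => ?_⟩
  · intro j k hjk
    refine (isLUB_iff.1 (hg j) _).1 ?_
    rintro _ ⟨i, rfl, rfl⟩
    refine mul_eq_zero_comm.1 ((isLUB_iff.1 (hg k) _).1 ?_)
    rintro _ ⟨i', rfl, rfl⟩
    exact hf.1.1 fun h => hjk (congrArg π h.symm)
  · refine ⟨?_, fun u hu => hf.1.2.2 ?_⟩
    · rintro _ ⟨j, rfl⟩
      exact hge j
    · rintro _ ⟨i, rfl⟩
      exact (hfg i).trans (hu ⟨π i, rfl⟩)
  -- Surjectivity makes each fibre nonempty, so `g j` lies between some `f i ∼ e` and `e`.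
  · obtain ⟨i, rfl⟩ := hπ j
    exact (hf.2 i).of_le_of_le (hfg i) (hge _)

theorem mem_Delta_of_le [IsAWStarAlgebra A] {e : AWProj A} {c d : Cardinal.{u}}
    (hc : c ∈ e.Delta) (hd : d ≠ 0) (hdc : d ≤ c) : d ∈ e.Delta := by
  obtain ⟨I, f, hf, rfl⟩ := hc
  induction d using Cardinal.inductionOn with
  | mk J =>
    obtain ⟨k⟩ := hdc
    have : Nonempty J := Cardinal.mk_ne_zero_iff.1 hd
    obtain ⟨g, hg⟩ := hf.exists_of_surjective (Function.invFun_surjective k.injective)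
    exact ⟨J, g, hg, rfl⟩

/-- Each member of a family indexed by `I` is equivalent to `e`, so a family of size `c i` can be
transported under it; the union over all members has sum `e`. -/
theorem sum_mem_Delta [IsAWStarAlgebra A] {e : AWProj A} {I : Type u} {c : I → Cardinal.{u}}
    (hI : Cardinal.mk I ∈ e.Delta) (hc : ∀ i, c i ∈ e.Delta) : Cardinal.sum c ∈ e.Delta := by
  obtain ⟨J, f, hf, hJ⟩ := hI
  obtain ⟨t⟩ := Cardinal.eq.1 hJ
  choose K g hg hK using hc
  choose k hk using fun j => (hg (t j)).exists_of_equivalent (hf.2 j).symm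
  refine ⟨Σ j, K (t j), fun x => k x.1 x.2, ⟨⟨?_, ?_⟩, fun x => ?_⟩, ?_⟩
  · rintro ⟨i, x⟩ ⟨j, y⟩ hxy
    by_cases hij : i = j
    · subst hij
      exact (hk i).1.1 fun h => hxy (congrArg (Sigma.mk i) h)
    · exact mul_eq_zero_of_le_of_le ((hk i).1.2.1 ⟨x, rfl⟩) ((hk j).1.2.1 ⟨y, rfl⟩)
        (hf.1.1 hij)
  · rw [isLUB_range_iff]
    intro x
    rw [← isLUB_range_iff.1 hf.1.2, Sigma.forall]
    exact forall_congr' fun j => isLUB_range_iff.1 (hk j).1.2 x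
  · exact ((hk x.1).2 x.2).trans (hf.2 x.1)
  · rw [Cardinal.mk_congr (Equiv.sigmaCongrLeft t),
      Cardinal.mk_sigma]
    exact congrArg Cardinal.sum (funext hK)

/-- Squaring the sum shows that `e₁` and `e₂` anticommute; idempotence then makes them commute, so
`2 e₁ e₂ = 0`. -/
theorem mul_eq_zero_of_eq_add {e e₁ e₂ : AWProj A} (h : e.val = e₁.val + e₂.val) :
    e₁.val * e₂.val = 0 := by
  have h0 : e₁.val * e₂.val + e₂.val * e₁.val = 0 := by
    have := e.mul_val
    rw [h, add_mul, mul_add, mul_add, mul_val, mul_val, add_assoc, add_right_inj,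
      ← add_assoc, add_eq_right] at this
    exact this
  have h1 : e₁.val * e₂.val = -(e₂.val * e₁.val) := eq_neg_of_add_eq_zero_left h0
  have h2 : e₁.val * e₂.val = e₂.val * e₁.val := by
    calc e₁.val * e₂.val = e₁.val * (e₁.val * e₂.val) := by rw [← mul_assoc, mul_val]
      _ = -(e₁.val * e₂.val * e₁.val) := by
        rw [h1, mul_neg, neg_mul, neg_neg, ← mul_assoc, h1, neg_mul, neg_neg]
      _ = e₂.val * e₁.val := by rw [h1, neg_mul, neg_neg, mul_assoc, mul_val]
  rw [← h2, ← two_smul ℂ] at h0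
  exact (smul_eq_zero.1 h0).resolve_left two_ne_zero

/-! ### Countable families from proper infiniteness -/

/-- Isometries with initial projection `e` and orthogonal ranges below `e`. -/
theorem exists_orthogonal_isometries {e e₁ e₂ : AWProj A} (h₁ : e₁.Equivalent e)
    (h₂ : e₂.Equivalent e) (h : e.val = e₁.val + e₂.val) :
    ∃ v : ℕ → A, (∀ n, star (v n) * v n = e.val) ∧ (∀ n, e.val * v n = v n) ∧
      Pairwise fun m n => star (v m) * v n = 0 := by
  obtain ⟨u, hu, hu'⟩ := h₁
  obtain ⟨w, hw, hw'⟩ := h₂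
  have h12 := mul_eq_zero_of_eq_add h
  have h21 := mul_eq_zero_comm.1 h12
  have heu : e.val * u = u := by
    rw [← mul_of_mul_star_eq hu, ← mul_assoc, h, add_mul, mul_val, h21, add_zero]
  have hew : e.val * w = w := by
    rw [← mul_of_mul_star_eq hw, ← mul_assoc, h, add_mul, mul_val, h12, zero_add]
  have huw : star u * w = 0 := by
    have : star u * e₁.val = star u := by
      simpa [star_mul, star_val] using congrArg star (mul_of_mul_star_eq hu)
    rw [← this, ← mul_of_mul_star_eq hw, mul_assoc, ← mul_assoc e₁.val, h12, zero_mul, mul_zero]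
  have hev : ∀ n, e.val * (w ^ n * u) = w ^ n * u := by
    rintro (_ | n)
    · rw [pow_zero, one_mul, heu]
    · rw [pow_succ', mul_assoc, ← mul_assoc, hew]
  have hstep : ∀ m n, star (w ^ (m + 1) * u) * (w ^ (n + 1) * u) =
      star (w ^ m * u) * (w ^ n * u) := by
    intro m n
    rw [pow_succ', pow_succ', mul_assoc, star_mul, mul_assoc w, mul_assoc, ← mul_assoc (star w),
      ← hw', hev]
  have hlt : ∀ m n, m < n → star (w ^ m * u) * (w ^ n * u) = 0 := by
    intro m
    induction m with
    | zero =>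
      rintro (_ | n) hn
      · exact absurd hn (lt_irrefl _)
      · rw [pow_zero, one_mul, pow_succ', mul_assoc, ← mul_assoc, huw, zero_mul]
    | succ m ih =>
      rintro (_ | n) hn
      · exact absurd hn (Nat.not_lt_zero _)
      · rw [hstep, ih n (Nat.lt_of_succ_lt_succ hn)]
  -- As in the Cuntz relations: `u` and `w` have orthogonal ranges, so the words `wⁿ u` do too.
  refine ⟨fun n => w ^ n * u, fun n => ?_, hev, fun m n hmn => ?_⟩
  · induction n with
    | zero => simpa using hu'.symm
    | succ n ih => exact (hstep n n).trans ih
  · rcases hmn.lt_or_gt with hmn | hmn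
    · exact hlt m n hmn
    · have := congrArg star (hlt n m hmn)
      rwa [star_mul, star_star, star_zero] at this

theorem IsProperlyInfinite.aleph0_mem_Delta [IsAWStarAlgebra A] {e : AWProj A}
    (he : e.IsProperlyInfinite) : Cardinal.aleph0 ∈ e.Delta := by
  obtain ⟨-, e₁, e₂, h12, h2, h⟩ := he
  obtain ⟨v, hv, hev, horth⟩ := exists_orthogonal_isometries (h12.trans h2) h2 h
  have hve : ∀ n, v n * e.val = v n := fun n => mul_of_star_mul_eq (hv n).symm
  let f : ULift.{u} ℕ → AWProj A := fun n =>
    ⟨v n.down * star (v n.down), by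
      rw [isStarProjection_iff']
      refine ⟨?_, by rw [star_mul, star_star]⟩
      rw [mul_assoc, ← mul_assoc (star _), hv, ← mul_assoc, hve]⟩
  have hfe : ∀ n, (f n).Equivalent e := fun n => ⟨v n.down, rfl, (hv _).symm⟩
  have hle : ∀ n, f n ≤ e := fun n => by
    rw [le_iff_right]
    change e.val * (v n.down * star (v n.down)) = v n.down * star (v n.down)
    rw [← mul_assoc, hev]
  -- The supremum `g` of the ranges may be smaller than `e`, but `g ∼ e` by Schröder–Bernstein, so
  -- the family can be transported to one with sum `e`.
  obtain ⟨g, hg⟩ := exists_isLUB (Set.range f)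
  have hge : g.Equivalent e :=
    (hfe ⟨0⟩).of_le_of_le (hg.1 ⟨_, rfl⟩) (hg.2 (by rintro _ ⟨n, rfl⟩; exact hle n))
  have hgf : g.MemGamma f := by
    refine ⟨⟨fun m n hmn => ?_, hg⟩, fun n => (hfe n).trans hge.symm⟩
    change v m.down * star (v m.down) * (v n.down * star (v n.down)) = 0
    rw [mul_assoc, ← mul_assoc (star _), horth fun h => hmn (ULift.ext _ _ h), zero_mul, mul_zero]
  obtain ⟨f', hf'⟩ := hgf.exists_of_equivalent hge
  exact ⟨_, f', hf', by simp⟩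

end AWProj

theorem propositionA1 {A : Type u} [CStarAlgebra A] [IsAWStarAlgebra A] (e : AWProj A)
    (he : e.IsProperlyInfinite) (h : ¬ IsWeaklyInaccessible e.delta) :
    e.delta ∈ e.Delta := by
  have hbdd := AWProj.bddAbove_Delta he.1
  have hne : e.Delta.Nonempty := ⟨_, he.aleph0_mem_Delta⟩
  have hle : Cardinal.aleph0 ≤ e.delta := le_csSup hbdd he.aleph0_mem_Delta
  have hmem : ∀ c < e.delta, c ≠ 0 → c ∈ e.Delta := fun c hc hc0 => by
    obtain ⟨d, hd, hcd⟩ := exists_lt_of_lt_csSup hne hc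
    exact AWProj.mem_Delta_of_le hd hc0 hcd.le
  rcases hle.eq_or_lt with heq | hlt
  · exact heq ▸ he.aleph0_mem_Delta
  by_cases hlim : Order.IsSuccLimit e.delta
  · have hcof : e.delta.ord.cof < e.delta :=
      lt_of_not_ge fun hcof => h ⟨hlt, ⟨hle, hcof⟩, hlim⟩
    obtain ⟨I, c, hI, hc, hsum⟩ := Cardinal.exists_sum_eq_of_cof_lt hle hcof hlim
    rw [← hsum]
    refine AWProj.sum_mem_Delta (hmem _ hI fun hI0 => ?_) fun i => hmem _ (hc i).2 (hc i).1
    have : IsEmpty I := Cardinal.mk_eq_zero_iff.1 hI0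
    have h0 : Cardinal.sum c = 0 := by
      rw [← nonpos_iff_eq_zero]
      exact (Cardinal.sum_le_mk_mul_iSup c).trans (by rw [hI0, zero_mul])
    exact absurd (hsum.symm.trans h0) (Cardinal.aleph0_pos.trans_le hle).ne'
  · exact csSup_mem_of_not_isSuccLimit hne hbdd hlim
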